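/- Let $\mathcal{FL}=\{\wedge,\vee,\cdot,\to,1\}$ with $\wedge,\vee,\cdot,\to$ binary and $1$ nullary, and let $0,\bot,\top$ be nullary and $!$ unary; write $\neg\alpha$ for $\alpha\to 0$. Formulas are built from a countably infinite set of variables. Consider the axiom schemes - (A1) $\alpha\to\alpha$; (A2) $\alpha\wedge\beta\to\alpha$; (A3) $\alpha\wedge\beta\to\beta$; (A4) $\alpha\to\alpha\vee\beta$; (A5) $\beta\to\alpha\vee\beta$; (A6) $(\alpha\to\beta)\to((\beta\to\gamma)\to(\alpha\to\gamma))$; (A7) $(\alpha\to(\beta\to\gamma))\to(\beta\to(\alpha\to\gamma))$; (A8) $(\alpha\to\beta)\wedge(\alpha\to\gamma)\to(\alpha\to\beta\wedge\gamma)$; (A9) $(\alpha\to\gamma)\wedge(\beta\to\gamma)\to(\alpha\vee\beta\to\gamma)$; (A10) $\alpha\to(\beta\to\alpha\cdot\beta)$; (A11) $(\alpha\to(\beta\to\gamma))\to(\alpha\cdot\beta\to\gamma)$; (A12) $1$; (A13) $1\to(\alpha\to\alpha)$; - (bounds) $\alpha\to\top$; $\bot\to\alpha$; - (negation) $\neg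 0$; $\alpha\to(\neg\alpha\to 0)$; $\neg\neg\alpha\to\alpha$; $(\alpha\to\neg\beta)\to(\beta\to\neg\alpha)$; - (exponential) $\beta\to(!\alpha\to\beta)$; $(!\alpha\to(!\alpha\to\beta))\to(!\alpha\to\beta)$; $!(\alpha\to\beta)\to(!\alpha\to{!\beta})$; $!\alpha\to\alpha$; $!\alpha\to{!!\alpha}$ and the rules (mp) from $\alpha$ and $\alpha\to\beta$ infer $\beta$, (adj) from $\alpha$ and $\beta$ infer $\alpha\wedge\beta$, (nec) from $\alpha$ infer $!\alpha$. Let $\vdash_{\mathrm{RL}_e}$ and $\vdash_{\mathrm{FL}_e}$ be the consequence relations (derivability from a set of premises) given by (A1)–(A13), (mp), (adj) over the languages $\mathcal{FL}$ and $\mathcal{FL}\cup\{0\}$, respectively; let $\vdash_{\mathrm{MALL}}$ be given over $\mathcal{FL}\cup\{0,\bot,\top\}$ by adding the bounds and negation schemes, and $\vdash_{\mathrm{LL}}$ over $\mathcal{FL}\cup\{0,\bot,\top,!\}$ by further adding the exponential schemes and (nec), where rules may be applied to premises. For an abelian group $\mathbf G$ (written multiplicatively) order $G\cup\{\bot,\top\}$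 by making $\bot$ least, $\top$ greatest and distinct elements of $G$ incomparable; extend the multiplication of $\mathbf G$ by $a\cdot\top=\top\cdot a=\top$ for $a\neq\bot$ and $b\cdot\bot=\bot\cdot b=\bot$ for all $b$; let $a\to c=\max\{b: ab\le c\}$, let $0$ denote the unit $1$ of $\mathbf G$, and let $!a=a\wedge 1$. For $S\subseteq\{0,\bot,\top,!\}$ let $\mathbf G^S$ be the resulting algebra over $\mathcal{FL}\cup S$. For a set $P$ of primes let $\mathsf V_P^S$ be the variety generated by all algebras isomorphic to $\mathbf G^S$ for an abelian group $\mathbf G$ with $x^p=1\Rightarrow x=1$ for all $p\in P$, together with the trivial algebras. For $\mathrm L\in\{\mathrm{LL},\mathrm{MALL},\mathrm{FL}_e,\mathrm{RL}_e\}$, with $S=\{0,\bot,\top,!\}$, $\{0,\bot,\top\}$, $\{0\}$, $\emptyset$ respectively, let $\vdash_{\mathrm L}^P$ be the axiomatic extension of $\vdash_{\mathrm L}$ corresponding to $\mathsf V_P^S$: $\Gamma\vdash_{\mathrm L}^P\varphi$ if and only if $\Gamma\cup\Sigma\vdash_{\mathrm L}\varphi$, where $\Sigma$ is the set of formulas $\sigma$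 for which $\mathsf V_P^S$ satisfies the equation $\sigma\wedge 1\approx 1$. A consequence relation $\vdash$ has the Craig interpolation property if, whenever $\vdash\varphi\to\psi$, there is a formula $\delta$ with $\vdash\varphi\to\delta$ and $\vdash\delta\to\psi$ all of whose variables occur in both $\varphi$ and $\psi$. **Corollary.** For every nonempty set $P$ of prime numbers, none of $\vdash_{\mathrm{LL}}^P$, $\vdash_{\mathrm{MALL}}^P$, $\vdash_{\mathrm{FL}_e}^P$, $\vdash_{\mathrm{RL}_e}^P$ has the Craig interpolation property. -/

import Mathlib

universe u

open FirstOrder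

namespace LinLog

/-! ### Languages and formulas -/

/-- The connectives that may be added to the basic language `{∧, ∨, ·, →, 1}`. -/
inductive Extra : Type
  | zero
  | bot
  | top
  | bang

/-- The connectives of the language `{∧, ∨, ·, →, 1} ∪ S`, sorted by arity. -/
inductive Conn (S : Set Extra) : ℕ → Type
  | one : Conn S 0
  | zero (h : Extra.zero ∈ S) : Conn S 0
  | bot (h : Extra.bot ∈ S) : Conn S 0
  | top (h : Extra.top ∈ S) : Conn S 0
  | bang (h : Extra.bang ∈ S) : Conn S 1
  | meet : Conn S 2
  | join : Conn S 2
  | mul : Conn S 2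
  | imp : Conn S 2

/-- The algebraic language `{∧, ∨, ·, →, 1} ∪ S`; it has no relation symbols. -/
@[reducible] def lang (S : Set Extra) : FirstOrder.Language.{0, 0} where
  Functions := Conn S
  Relations := fun _ => Empty

instance (S : Set Extra) : (lang S).IsAlgebraic :=
  fun _ => inferInstanceAs (IsEmpty Empty)

/-- Formulas over `{∧, ∨, ·, →, 1} ∪ S` in the countably many variables `0, 1, 2, …`.
The logical formulas are the terms of the algebraic language. -/
abbrev Fm (S : Set Extra) : Type := (lang S).Term ℕ

namespace Fm

variable {S : Set Extra}

def meet (a b : Fm S) : Fm S := Language.Functions.apply₂ (L := lang S) Conn.meet a b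
def join (a b : Fm S) : Fm S := Language.Functions.apply₂ (L := lang S) Conn.join a b
def mul (a b : Fm S) : Fm S := Language.Functions.apply₂ (L := lang S) Conn.mul a b
def imp (a b : Fm S) : Fm S := Language.Functions.apply₂ (L := lang S) Conn.imp a b
def one : Fm S := Language.Constants.term (L := lang S) Conn.one
def zero (h : Extra.zero ∈ S) : Fm S := Language.Constants.term (L := lang S) (Conn.zero h)
def bot (h : Extra.bot ∈ S) : Fm S := Language.Constants.term (L := lang S) (Conn.bot h)
def top (h : Extra.top ∈ S) : Fm S := Language.Constants.term (L := lang S) (Conn.top h)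
def bang (h : Extra.bang ∈ S) (a : Fm S) : Fm S :=
  Language.Functions.apply₁ (L := lang S) (Conn.bang h) a

/-- `¬ a` abbreviates `a → 0`. -/
def neg (h : Extra.zero ∈ S) (a : Fm S) : Fm S := imp a (zero h)

end Fm

/-! ### The Hilbert calculus -/

/-- Axiom schemes of the full Lambek calculus with exchange. -/
inductive AxFLe {S : Set Extra} : Fm S → Prop
  | a1 (a : Fm S) : AxFLe (a.imp a)
  | a2 (a b : Fm S) : AxFLe ((a.meet b).imp a)
  | a3 (a b : Fm S) : AxFLe ((a.meet b).imp b)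
  | a4 (a b : Fm S) : AxFLe (a.imp (a.join b))
  | a5 (a b : Fm S) : AxFLe (b.imp (a.join b))
  | a6 (a b c : Fm S) : AxFLe ((a.imp b).imp ((b.imp c).imp (a.imp c)))
  | a7 (a b c : Fm S) : AxFLe ((a.imp (b.imp c)).imp (b.imp (a.imp c)))
  | a8 (a b c : Fm S) : AxFLe (((a.imp b).meet (a.imp c)).imp (a.imp (b.meet c)))
  | a9 (a b c : Fm S) : AxFLe (((a.imp c).meet (b.imp c)).imp ((a.join b).imp c))
  | a10 (a b : Fm S) : AxFLe (a.imp (b.imp (a.mul b)))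
  | a11 (a b c : Fm S) : AxFLe ((a.imp (b.imp c)).imp ((a.mul b).imp c))
  | a12 : AxFLe Fm.one
  | a13 (a : Fm S) : AxFLe (Fm.one.imp (a.imp a))

/-- Axiom schemes for the bounds. -/
inductive AxBounds {S : Set Extra} (hb : Extra.bot ∈ S) (ht : Extra.top ∈ S) : Fm S → Prop
  | top (a : Fm S) : AxBounds hb ht (a.imp (Fm.top ht))
  | bot (a : Fm S) : AxBounds hb ht ((Fm.bot hb).imp a)

/-- Axiom schemes for the involutive negation. -/
inductive AxNeg {S : Set Extra} (h0 : Extra.zero ∈ S) : Fm S → Prop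
  | a0 : AxNeg h0 ((Fm.zero h0).neg h0)
  | nc (a : Fm S) : AxNeg h0 (a.imp ((a.neg h0).imp (Fm.zero h0)))
  | dn (a : Fm S) : AxNeg h0 (((a.neg h0).neg h0).imp a)
  | con (a b : Fm S) : AxNeg h0 ((a.imp (b.neg h0)).imp (b.imp (a.neg h0)))

/-- Axiom schemes for the exponential. -/
inductive AxBang {S : Set Extra} (h : Extra.bang ∈ S) : Fm S → Prop
  | w (a b : Fm S) : AxBang h (b.imp ((a.bang h).imp b))
  | i (a b : Fm S) :
      AxBang h (((a.bang h).imp ((a.bang h).imp b)).imp ((a.bang h).imp b))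
  | k (a b : Fm S) : AxBang h (((a.imp b).bang h).imp ((a.bang h).imp (b.bang h)))
  | t (a : Fm S) : AxBang h ((a.bang h).imp a)
  | four (a : Fm S) : AxBang h ((a.bang h).imp ((a.bang h).bang h))

/-- Derivability from the axioms `Ax` and the premises `Γ` by modus ponens, adjunction and, when
the exponential belongs to the language, necessitation (which applies to all derived formulas,
including those derived from premises). -/
inductive Derives {S : Set Extra} (Ax : Fm S → Prop) (Γ : Set (Fm S)) : Fm S → Prop
  | ax {a : Fm S} : Ax a → Derives Ax Γ a
  | hyp {a : Fm S} : a ∈ Γ → Derives Ax Γ a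
  | mp {a b : Fm S} : Derives Ax Γ a → Derives Ax Γ (a.imp b) → Derives Ax Γ b
  | adj {a b : Fm S} : Derives Ax Γ a → Derives Ax Γ b → Derives Ax Γ (a.meet b)
  | nec (h : Extra.bang ∈ S) {a : Fm S} : Derives Ax Γ a → Derives Ax Γ (a.bang h)

/-- Relations from sets of formulas to formulas, of which consequence relations are a special
case. -/
abbrev Consequence (S : Set Extra) : Type := Set (Fm S) → Fm S → Prop

abbrev langRLe : Set Extra := ∅
abbrev langFLe : Set Extra := {Extra.zero}
abbrev langMALL : Set Extra := {Extra.zero, Extra.bot, Extra.top}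
abbrev langLL : Set Extra := {Extra.zero, Extra.bot, Extra.top, Extra.bang}

/-- The `0`-free fragment of the full Lambek calculus with exchange. -/
def RLe : Consequence langRLe := Derives AxFLe

/-- The full Lambek calculus with exchange. -/
def FLe : Consequence langFLe := Derives AxFLe

/-- Classical multiplicative-additive linear logic. -/
def MALL : Consequence langMALL :=
  Derives fun a => AxFLe a ∨ AxBounds (by simp) (by simp) a ∨ AxNeg (by simp) a

/-- Full classical linear logic. -/
def LL : Consequence langLL :=
  Derives fun a =>
    AxFLe a ∨ AxBounds (by simp) (by simp) a ∨ AxNeg (by simp) a ∨ AxBang (by simp) a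

/-- The axiomatic extension of `C` by the set `T` of formulas. -/
def axiomaticExtension {S : Set Extra} (C : Consequence S) (T : Set (Fm S)) : Consequence S :=
  fun Γ a => C (Γ ∪ T) a

/-- The Craig interpolation property. -/
def HasCraigInterpolation {S : Set Extra} (C : Consequence S) : Prop :=
  ∀ a b : Fm S, C ∅ (a.imp b) →
    ∃ d : Fm S, C ∅ (a.imp d) ∧ C ∅ (d.imp b) ∧ d.varFinset ⊆ a.varFinset ∩ b.varFinset

/-! ### Varieties -/

/-- Classes of algebras over a language without relation symbols. -/
abbrev AlgClass (L : FirstOrder.Language.{0, 0}) : Type (u + 1) :=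
  Set (CategoryTheory.Bundled.{u} L.Structure)

section Varieties

variable {L : FirstOrder.Language.{0, 0}} [L.IsAlgebraic]

/-- The direct product of algebras, with the operations defined coordinatewise. -/
def prodAlg {I : Type u} (A : I → CategoryTheory.Bundled.{u} L.Structure) :
    CategoryTheory.Bundled.{u} L.Structure where
  α := ∀ i, A i
  str :=
    { funMap := fun f x i => Language.Structure.funMap f fun j => x j i
      RelMap := fun r _ => isEmptyElim r }

/-- Homomorphic images. -/
def homImages (K : AlgClass.{u} L) : AlgClass.{u} L :=
  {B | ∃ A ∈ K, ∃ f : A →[L] B, Function.Surjective f}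

/-- Subalgebras, up to isomorphism. -/
def subalgebras (K : AlgClass.{u} L) : AlgClass.{u} L :=
  {B | ∃ A ∈ K, Nonempty (B ↪[L] A)}

/-- Direct products, up to isomorphism. -/
def products (K : AlgClass.{u} L) : AlgClass.{u} L :=
  {B | ∃ (I : Type u) (A : I → CategoryTheory.Bundled.{u} L.Structure),
    (∀ i, A i ∈ K) ∧ Nonempty (B ≃[L] prodAlg A)}

/-- The variety generated by `K`. -/
def generatedVariety (K : AlgClass.{u} L) : AlgClass.{u} L :=
  homImages (subalgebras (products K))

/-- The equation `s ≈ t` holds in every algebra of `K` under every assignment. -/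
def Satisfies (K : AlgClass.{u} L) (s t : L.Term ℕ) : Prop :=
  ∀ A ∈ K, ∀ v : ℕ → A, s.realize v = t.realize v

end Varieties

/-- The formulas `a` for which the variety `V` satisfies the defining equation `a ∧ 1 ≈ 1`. -/
def theoremsOf {S : Set Extra} (V : AlgClass.{u} (lang S)) : Set (Fm S) :=
  {a | Satisfies V (a.meet Fm.one) Fm.one}

/-- `theoremsOf V` is closed under substitutions. -/
theorem subst_mem_theoremsOf {S : Set Extra} (V : AlgClass.{u} (lang S)) {a : Fm S}
    (ha : a ∈ theoremsOf V) (σ : ℕ → Fm S) : a.subst σ ∈ theoremsOf V := by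
  intro A hA v
  have h := ha A hA fun n => (σ n).realize v
  simp only [Fm.meet, Fm.one, Language.Term.realize_functions_apply₂,
    Language.Term.realize_constants, Language.Term.realize_subst] at h ⊢
  exact h

/-! ### Residuated lattices built from abelian groups -/

/-- The set `G ∪ {⊥, ⊤}`. -/
inductive Ext (G : Type u) : Type u
  | bot : Ext G
  | top : Ext G
  | elem (g : G) : Ext G

namespace Ext

variable {G : Type u}

/-- The order in which the elements of `G` are pairwise incomparable, `⊥` is the least and `⊤` the
greatest element. -/
def le (a b : Ext G) : Prop := a = bot ∨ b = top ∨ a = b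

open Classical in
noncomputable def meet : Ext G → Ext G → Ext G
  | top, b => b
  | a, top => a
  | elem g, elem h => if g = h then elem g else bot
  | _, _ => bot

open Classical in
noncomputable def join : Ext G → Ext G → Ext G
  | bot, b => b
  | a, bot => a
  | elem g, elem h => if g = h then elem g else top
  | _, _ => top

/-- `meet` is the greatest lower bound. -/
theorem le_meet (a b c : Ext G) : le c (meet a b) ↔ le c a ∧ le c b := by
  cases a <;> cases b <;> cases c <;> simp [le, meet] <;> split_ifs <;> simp_all

/-- `join` is the least upper bound. -/
theorem join_le (a b c : Ext G) : le (join a b) c ↔ le a c ∧ le b c := by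
  cases a <;> cases b <;> cases c <;> simp [le, join] <;> split_ifs <;> simp_all <;> grind

variable [CommGroup G]

def one : Ext G := elem 1

def mul : Ext G → Ext G → Ext G
  | bot, _ => bot
  | _, bot => bot
  | elem g, elem h => elem (g * h)
  | _, _ => top

def imp : Ext G → Ext G → Ext G
  | bot, _ => top
  | _, top => top
  | elem g, elem h => elem (g⁻¹ * h)
  | _, _ => bot

/-- `imp a c` is the largest `b` with `a * b ≤ c`. -/
theorem mul_le (a b c : Ext G) : le (mul a b) c ↔ le b (imp a c) := by
  cases a <;> cases b <;> cases c <;> simp [le, mul, imp, eq_inv_mul_iff_mul_eq]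

/-- The algebra on `G ∪ {⊥, ⊤}` over the language `{∧, ∨, ·, →, 1} ∪ S`, with `0` interpreted as
`1` and `! a` as `a ∧ 1`. -/
noncomputable instance algebra (S : Set Extra) : (lang S).Structure (Ext G) where
  funMap := fun f x =>
    match f, x with
    | Conn.one, _ => one
    | Conn.zero _, _ => one
    | Conn.bot _, _ => bot
    | Conn.top _, _ => top
    | Conn.bang _, x => meet (x 0) one
    | Conn.meet, x => meet (x 0) (x 1)
    | Conn.join, x => join (x 0) (x 1)
    | Conn.mul, x => mul (x 0) (x 1)
    | Conn.imp, x => imp (x 0) (x 1)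
  RelMap := fun r _ => nomatch r

end Ext

/-- The abelian group `G` has no element of order `p` for `p ∈ P`. -/
def InQ (P : Set ℕ) (G : Type u) [CommGroup G] : Prop :=
  ∀ p ∈ P, ∀ x : G, x ^ p = 1 → x = 1

/-- The algebras isomorphic to `G ∪ {⊥, ⊤}` for some abelian group `G` as in `InQ`, together with
the trivial algebras. -/
def classK (P : Set ℕ) (S : Set Extra) : AlgClass.{u} (lang S) :=
  {A | (∃ (G : Type u) (_ : CommGroup G), InQ P G ∧ Nonempty (A ≃[lang S] Ext G)) ∨
    Nonempty (Unique A)}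

/-- The variety generated by `classK P S`. -/
def varietyV (P : Set ℕ) (S : Set Extra) : AlgClass.{u} (lang S) :=
  generatedVariety (classK P S)

/-- The axiomatic extension of `C` that corresponds to the variety `varietyV P S`: the axioms added
to `C` are the formulas `a` such that the variety satisfies `a ∧ 1 ≈ 1`. -/
def extensionBy {S : Set Extra} (C : Consequence S) (P : Set ℕ) : Consequence S :=
  axiomaticExtension C (theoremsOf (varietyV.{u} P S))

end LinLog

/-!
An equation that holds in a class of algebras holds in the variety it generates, and the calculi are
sound for the algebras `Ext G`. Hence `a → b` is a theorem of the extension if and only if `a ≤ b`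
holds in `Ext G` under all assignments, for every `G` without `p`-torsion for `p ∈ P`.

Fix `p ∈ P`. In an abelian group without elements of order `p`, the `p`-th root of an element is
unique when it exists, but it need not be in the subgroup generated by that element. The term
`[a ≈ b] = (a → b) ∧ (b → a) ∧ 1` takes the value `1` in `Ext G` if `a = b`, and `⊥` otherwise
(`Ext.indicator_eq`). Uniqueness of roots therefore makes

  `[x ≈ yᵖ] · y ≤ [x ≈ zᵖ] → z`

valid (`rootLeft_imp_rootRight_mem`). An interpolant would be a term `d(x)` with
`[x ≈ yᵖ] · y ≤ d(x) ≤ [x ≈ zᵖ] → z`. In the infinite cyclic group generated by `g`, let `x = gᵖ`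
and `y = z = g`; both bounds become `g`, so `d(gᵖ) = g`. But `d(gᵖ)` is `⊥`, `⊤` or a power of `gᵖ`
(`Ext.realize_mem_subgroup`), and `g` is none of these.
-/

namespace LinLog

open FirstOrder

/-! ### Equations in generated varieties -/

section Varieties

variable {L : FirstOrder.Language.{0, 0}} [L.IsAlgebraic]

theorem subset_generatedVariety (K : AlgClass.{u} L) : K ⊆ generatedVariety K := by
  intro A hA
  have hprod : Nonempty (A ≃[L] prodAlg fun _ : PUnit.{u + 1} => A) :=
    ⟨{ toFun := fun a _ => a
       invFun := fun x => x PUnit.unit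
       left_inv := fun _ => rfl
       right_inv := fun _ => rfl
       map_fun' := fun _ _ => rfl
       map_rel' := fun r _ => isEmptyElim r }⟩
  exact ⟨A, ⟨A, ⟨PUnit, fun _ => A, fun _ => hA, hprod⟩,
    ⟨Language.Embedding.refl L A⟩⟩, Language.Hom.id L A, Function.surjective_id⟩

theorem prodAlg_realize {I : Type u} (A : I → CategoryTheory.Bundled.{u} L.Structure)
    (t : L.Term ℕ) (v : ℕ → prodAlg A) (i : I) :
    (t.realize v : prodAlg A) i = t.realize fun n => v n i := by
  induction t with
  | var n => rfl
  | func f ts ih =>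
    simp only [Language.Term.realize_func, ← ih]
    rfl

theorem Satisfies.generatedVariety {K : AlgClass.{u} L} {s t : L.Term ℕ}
    (h : Satisfies K s t) : Satisfies (generatedVariety K) s t := by
  rintro B ⟨C, ⟨D, ⟨I, A, hA, ⟨e⟩⟩, ⟨j⟩⟩, f, hf⟩ v
  have hD (w : ℕ → D) : s.realize w = t.realize w := by
    apply e.injective
    rw [← Language.HomClass.realize_term e, ← Language.HomClass.realize_term e]
    funext i
    rw [prodAlg_realize, prodAlg_realize]
    exact h _ (hA i) _
  have hC (w : ℕ → C) : s.realize w = t.realize w := by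
    apply j.injective
    rw [← Language.HomClass.realize_term j, ← Language.HomClass.realize_term j]
    exact hD _
  obtain ⟨w, rfl⟩ : ∃ w : ℕ → C, v = f ∘ w := by
    choose g hg using hf
    exact ⟨g ∘ v, funext fun n => (hg (v n)).symm⟩
  rw [Language.HomClass.realize_term f, Language.HomClass.realize_term f, hC]

end Varieties

/-! ### Terms in the algebras `Ext G` -/

section Realize

variable {S : Set Extra} {G : Type u} [CommGroup G] (v : ℕ → Ext G) (a b : Fm S)

@[simp] theorem realize_meet : (a.meet b).realize v = (a.realize v).meet (b.realize v) := by
  rw [Fm.meet, Language.Term.realize_functions_apply₂]; rfl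

@[simp] theorem realize_join : (a.join b).realize v = (a.realize v).join (b.realize v) := by
  rw [Fm.join, Language.Term.realize_functions_apply₂]; rfl

@[simp] theorem realize_mul : (a.mul b).realize v = (a.realize v).mul (b.realize v) := by
  rw [Fm.mul, Language.Term.realize_functions_apply₂]; rfl

@[simp] theorem realize_imp : (a.imp b).realize v = (a.realize v).imp (b.realize v) := by
  rw [Fm.imp, Language.Term.realize_functions_apply₂]; rfl

@[simp] theorem realize_one : (Fm.one : Fm S).realize v = Ext.one := by
  rw [Fm.one, Language.Term.realize_constants]; rfl

@[simp] theorem realize_zero (h : Extra.zero ∈ S) : (Fm.zero h).realize v = Ext.one := by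
  rw [Fm.zero, Language.Term.realize_constants]; rfl

@[simp] theorem realize_bot (h : Extra.bot ∈ S) : (Fm.bot h).realize v = Ext.bot := by
  rw [Fm.bot, Language.Term.realize_constants]; rfl

@[simp] theorem realize_top (h : Extra.top ∈ S) : (Fm.top h).realize v = Ext.top := by
  rw [Fm.top, Language.Term.realize_constants]; rfl

@[simp] theorem realize_bang (h : Extra.bang ∈ S) :
    (a.bang h).realize v = (a.realize v).meet Ext.one := by
  rw [Fm.bang, Language.Term.realize_functions_apply₁]; rfl

end Realize

namespace Ext

variable {G : Type u}

theorem le_refl (a : Ext G) : le a a := Or.inr (Or.inr rfl)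

theorem le_trans {a b c : Ext G} (hab : le a b) (hbc : le b c) : le a c := by
  rcases hab with rfl | rfl | rfl
  · exact Or.inl rfl
  · rcases hbc with h | rfl | rfl
    · cases h
    · exact Or.inr (Or.inl rfl)
    · exact Or.inr (Or.inl rfl)
  · exact hbc

theorem le_antisymm {a b : Ext G} (hab : le a b) (hba : le b a) : a = b := by
  cases a <;> cases b <;> simp_all [le]

variable [CommGroup G]

theorem mul_comm' (a b : Ext G) : mul a b = mul b a := by
  cases a <;> cases b <;> simp [mul, mul_comm]

theorem mul_one' (a : Ext G) : mul a one = a := by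
  cases a <;> simp [mul, one]

theorem one_mul' (a : Ext G) : mul one a = a := by
  rw [mul_comm', mul_one']

theorem one_le_imp {a b : Ext G} : le one (imp a b) ↔ le a b := by
  rw [← mul_le, mul_one']

theorem one_imp (a : Ext G) : imp one a = a := by
  cases a <;> simp [imp, one]

theorem imp_le_of_one_le {a b : Ext G} (h : le one a) : le (imp a b) b := by
  cases a with
  | bot => cases h <;> simp_all [one]
  | top => cases b <;> simp [le, imp]
  | elem g =>
    obtain rfl : 1 = g := by simpa [le, one] using h
    cases b <;> simp [le, imp]

theorem imp_le_imp_imp (a b c : Ext G) : le (imp a b) (imp (imp b c) (imp a c)) := by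
  cases a <;> cases b <;> cases c <;> simp [le, imp, mul_comm, mul_left_comm]

theorem imp_left_comm_le (a b c : Ext G) : le (imp a (imp b c)) (imp b (imp a c)) := by
  cases a <;> cases b <;> cases c <;> simp [le, imp, mul_left_comm]

theorem imp_imp_le_mul_imp (a b c : Ext G) : le (imp a (imp b c)) (imp (mul a b) c) := by
  cases a <;> cases b <;> cases c <;> simp [le, imp, mul, mul_comm, mul_left_comm]

theorem imp_meet_imp_le (a b c : Ext G) :
    le (meet (imp a b) (imp a c)) (imp a (meet b c)) := by
  rw [← mul_le, le_meet, mul_le, mul_le, ← le_meet]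
  exact le_refl _

theorem meet_imp_le_join_imp (a b c : Ext G) :
    le (meet (imp a c) (imp b c)) (imp (join a b) c) := by
  rw [← mul_le, mul_comm', mul_le, join_le, ← mul_le, ← mul_le, mul_comm' _ a, mul_comm' _ b,
    mul_le, mul_le, ← le_meet]
  exact le_refl _

theorem le_imp_mul (a b : Ext G) : le a (imp b (mul a b)) := by
  rw [← mul_le, mul_comm']
  exact le_refl _

theorem meet_one_eq_one {a : Ext G} : meet a one = one ↔ le one a := by
  constructor
  · intro h
    exact ((le_meet a one one).1 (h.symm ▸ le_refl one)).1
  · intro h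
    exact le_antisymm ((le_meet a one _).1 (le_refl _)).2 ((le_meet a one one).2 ⟨h, le_refl _⟩)

open Classical in
/-- The term `(a → b) ∧ (b → a) ∧ 1` is the indicator of equality. -/
theorem indicator_eq (a b : Ext G) :
    meet (meet (imp a b) (imp b a)) one = if a = b then one else bot := by
  split_ifs with h
  · subst h
    cases a <;> simp [imp, meet, one]
  · rcases a with _ | _ | g <;> rcases b with _ | _ | k <;>
      first
      | exact absurd rfl h
      | rfl
      | skip
    have hne : g⁻¹ * k ≠ 1 := fun hk => h (by rw [inv_mul_eq_one.1 hk])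
    simp only [imp, meet]
    split_ifs <;> simp [one, hne]

/-- If the elements of `G` among the values of the variables lie in a subgroup, then so does the
value of the term, unless it is `⊥` or `⊤`. -/
theorem realize_mem_subgroup {S : Set Extra} (H : Subgroup G) (d : Fm S) (v : ℕ → Ext G)
    (hv : ∀ n ∈ d.varFinset, ∀ g, v n = elem g → g ∈ H) :
    ∀ g, d.realize v = elem g → g ∈ H := by
  induction d with
  | var n => exact hv n (by simp [Language.Term.varFinset])
  | func f ts ih =>
    replace ih i := ih i fun n hn =>
      hv n (Finset.mem_biUnion.2 ⟨i, Finset.mem_univ i, hn⟩)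
    rw [Language.Term.realize_func]
    generalize hw : (fun i => (ts i).realize v) = w
    replace ih i g (h : w i = elem g) : g ∈ H := ih i g (by rw [← h, ← hw])
    intro g hg
    cases f with
    | one =>
      obtain rfl : 1 = g := elem.inj hg
      exact H.one_mem
    | zero _ =>
      obtain rfl : 1 = g := elem.inj hg
      exact H.one_mem
    | bot _ => cases hg
    | top _ => cases hg
    | bang _ =>
      change meet (w 0) one = elem g at hg
      have h0 := ih 0
      cases hx : w 0 <;> simp only [hx, meet, one] at hg h0
      · cases hg
      · obtain rfl : 1 = g := elem.inj hg
        exact H.one_mem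
      · grind
    | meet =>
      change meet (w 0) (w 1) = elem g at hg
      have h0 := ih 0
      have h1 := ih 1
      cases hx : w 0 <;> cases hy : w 1 <;> simp only [hx, hy, meet] at hg h0 h1 <;> grind
    | join =>
      change join (w 0) (w 1) = elem g at hg
      have h0 := ih 0
      have h1 := ih 1
      cases hx : w 0 <;> cases hy : w 1 <;> simp only [hx, hy, join] at hg h0 h1 <;> grind
    | mul =>
      change mul (w 0) (w 1) = elem g at hg
      have h0 := ih 0
      have h1 := ih 1
      cases hx : w 0 <;> cases hy : w 1 <;> rw [hx, hy, mul] at hg <;> cases hg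
      exact H.mul_mem (h0 _ hx) (h1 _ hy)
    | imp =>
      change imp (w 0) (w 1) = elem g at hg
      have h0 := ih 0
      have h1 := ih 1
      cases hx : w 0 <;> cases hy : w 1 <;> rw [hx, hy, imp] at hg <;> cases hg
      exact H.mul_mem (H.inv_mem (h0 _ hx)) (h1 _ hy)

end Ext

/-! ### Soundness -/

section Soundness

variable {S : Set Extra} {G : Type u} [CommGroup G] (v : ℕ → Ext G)

theorem AxFLe.sound {a : Fm S} (h : AxFLe a) : Ext.le Ext.one (a.realize v) := by
  cases h <;>
    simp only [realize_imp, realize_meet, realize_join, realize_mul, realize_one,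
      Ext.one_le_imp] <;>
    first
    | exact Ext.le_refl _
    | exact ((Ext.le_meet _ _ _).1 (Ext.le_refl _)).1
    | exact ((Ext.le_meet _ _ _).1 (Ext.le_refl _)).2
    | exact ((Ext.join_le _ _ _).1 (Ext.le_refl _)).1
    | exact ((Ext.join_le _ _ _).1 (Ext.le_refl _)).2
    | exact Ext.imp_le_imp_imp _ _ _
    | exact Ext.imp_left_comm_le _ _ _
    | exact Ext.imp_meet_imp_le _ _ _
    | exact Ext.meet_imp_le_join_imp _ _ _
    | exact Ext.le_imp_mul _ _
    | exact Ext.imp_imp_le_mul_imp _ _ _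

theorem AxBounds.sound {hb : Extra.bot ∈ S} {ht : Extra.top ∈ S} {a : Fm S}
    (h : AxBounds hb ht a) : Ext.le Ext.one (a.realize v) := by
  cases h <;> rw [realize_imp, Ext.one_le_imp]
  · exact Or.inr (Or.inl (realize_top v ht))
  · exact Or.inl (realize_bot v hb)

theorem AxNeg.sound {h0 : Extra.zero ∈ S} {a : Fm S} (h : AxNeg h0 a) :
    Ext.le Ext.one (a.realize v) := by
  cases h with
  | a0 =>
    rw [Fm.neg, realize_imp, Ext.one_le_imp]
    exact Ext.le_refl _
  | nc a =>
    simp only [Fm.neg, realize_imp, realize_zero, Ext.one_le_imp]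
    cases a.realize v <;> simp [Ext.le, Ext.imp, Ext.one]
  | dn a =>
    simp only [Fm.neg, realize_imp, realize_zero, Ext.one_le_imp]
    cases a.realize v <;> simp [Ext.le, Ext.imp, Ext.one]
  | con a b =>
    simp only [Fm.neg, realize_imp, realize_zero, Ext.one_le_imp]
    cases a.realize v <;> cases b.realize v <;> simp [Ext.le, Ext.imp, Ext.one, mul_comm]

theorem AxBang.sound {hb : Extra.bang ∈ S} {a : Fm S} (h : AxBang hb a) :
    Ext.le Ext.one (a.realize v) := by
  -- `! a` is `1` or `⊥`
  have key (x : Ext G) : x.meet Ext.one = Ext.one ∨ x.meet Ext.one = Ext.bot := by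
    cases x <;> simp only [Ext.meet, Ext.one, true_or, or_true]
    grind
  cases h with
  | w a b =>
    simp only [realize_imp, realize_bang, Ext.one_le_imp]
    rcases key (a.realize v) with h | h <;> rw [h, ← Ext.mul_le]
    · exact (Ext.one_mul' (b.realize v)).symm ▸ Ext.le_refl _
    · exact Or.inl rfl
  | i a b =>
    simp only [realize_imp, realize_bang, Ext.one_le_imp]
    rcases key (a.realize v) with h | h <;> rw [h]
    · rw [Ext.one_imp, Ext.one_imp]
      exact Ext.le_refl _
    · exact Or.inr (Or.inl rfl)
  | k a b =>
    simp only [realize_imp, realize_bang, Ext.one_le_imp]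
    rcases key (a.realize v) with h | h <;> rw [h]
    · rw [Ext.one_imp, Ext.le_meet]
      obtain ⟨h1, h2⟩ := (Ext.le_meet ((a.realize v).imp (b.realize v)) Ext.one _).1
        (Ext.le_refl _)
      exact ⟨Ext.le_trans h1 (Ext.imp_le_of_one_le (Ext.meet_one_eq_one.1 h)), h2⟩
    · exact Or.inr (Or.inl rfl)
  | t a =>
    simp only [realize_imp, realize_bang, Ext.one_le_imp]
    exact ((Ext.le_meet _ _ _).1 (Ext.le_refl _)).1
  | four a =>
    simp only [realize_imp, realize_bang, Ext.one_le_imp]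
    exact (Ext.le_meet _ _ _).2 ⟨Ext.le_refl _, ((Ext.le_meet _ _ _).1 (Ext.le_refl _)).2⟩

variable {v} in
/-- Necessitation preserves validity because `1 ≤ a` gives `1 ≤ a ∧ 1`. -/
theorem Derives.sound {Ax : Fm S → Prop} {Γ : Set (Fm S)}
    (hAx : ∀ a, Ax a → Ext.le Ext.one (a.realize v))
    (hΓ : ∀ a ∈ Γ, Ext.le Ext.one (a.realize v)) {a : Fm S} (h : Derives Ax Γ a) :
    Ext.le Ext.one (a.realize v) := by
  induction h with
  | ax h => exact hAx _ h
  | hyp h => exact hΓ _ h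
  | mp _ _ iha ihab =>
    rw [realize_imp, Ext.one_le_imp] at ihab
    exact Ext.le_trans iha ihab
  | adj _ _ iha ihb =>
    rw [realize_meet, Ext.le_meet]
    exact ⟨iha, ihb⟩
  | nec h _ ih =>
    rw [realize_bang, Ext.le_meet]
    exact ⟨ih, Ext.le_refl _⟩

end Soundness

/-! ### Theorems of the extensions -/

section Theorems

variable {P : Set ℕ} {S : Set Extra}

theorem one_le_realize_of_mem_theoremsOf {a : Fm S} (ha : a ∈ theoremsOf (varietyV.{u} P S))
    {G : Type u} [CommGroup G] (hG : InQ P G) (v : ℕ → Ext G) :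
    Ext.le Ext.one (a.realize v) := by
  have hmem : (⟨Ext G, Ext.algebra S⟩ : CategoryTheory.Bundled.{u} (lang S).Structure) ∈
      classK P S :=
    Or.inl ⟨G, inferInstance, hG, ⟨Language.Equiv.refl _ (Ext G)⟩⟩
  have h : (a.meet Fm.one).realize v = (Fm.one : Fm S).realize v :=
    ha _ (subset_generatedVariety _ hmem) v
  rwa [realize_meet, realize_one, Ext.meet_one_eq_one] at h

theorem mem_theoremsOf_of_one_le {a : Fm S}
    (h : ∀ (G : Type u) [CommGroup G], InQ P G → ∀ v : ℕ → Ext G, Ext.le Ext.one (a.realize v)) :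
    a ∈ theoremsOf (varietyV.{u} P S) := by
  apply Satisfies.generatedVariety
  rintro A (⟨G, _, hG, ⟨e⟩⟩ | ⟨⟨hA⟩⟩) v
  · apply e.injective
    rw [← Language.HomClass.realize_term e, ← Language.HomClass.realize_term e, realize_meet,
      realize_one, Ext.meet_one_eq_one]
    exact h G hG _
  · exact (hA.2 _).trans (hA.2 _).symm

theorem extensionBy_sound {Ax : Fm S → Prop}
    (hAx : ∀ (G : Type u) [CommGroup G] (v : ℕ → Ext G) a, Ax a → Ext.le Ext.one (a.realize v))
    {a b : Fm S} (h : extensionBy.{u} (Derives Ax) P ∅ (a.imp b))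
    {G : Type u} [CommGroup G] (hG : InQ P G) (v : ℕ → Ext G) :
    Ext.le (a.realize v) (b.realize v) := by
  rw [← Ext.one_le_imp, ← realize_imp]
  refine Derives.sound (hAx G v) (fun c hc => ?_) h
  rw [Set.empty_union] at hc
  exact one_le_realize_of_mem_theoremsOf hc hG v

end Theorems

/-! ### Failure of interpolation -/

section Root

variable {S : Set Extra}

/-- The term `aⁿ`. -/
def Fm.pow (a : Fm S) : ℕ → Fm S
  | 0 => Fm.one
  | n + 1 => (a.pow n).mul a

/-- The term `[a ≈ b] = (a → b) ∧ (b → a) ∧ 1`, whose value is `1` if `a = b` and `⊥` otherwise. -/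
def Fm.indicator (a b : Fm S) : Fm S := ((a.imp b).meet (b.imp a)).meet Fm.one

/-- The term `[x ≈ yⁿ] · y`, where `x` and `y` are the variables `0` and `1`. -/
def rootLeft (S : Set Extra) (n : ℕ) : Fm S :=
  (Fm.indicator (.var 0) (Fm.pow (.var 1) n)).mul (.var 1)

/-- The term `[x ≈ zⁿ] → z`, where `x` and `z` are the variables `0` and `2`. -/
def rootRight (S : Set Extra) (n : ℕ) : Fm S :=
  (Fm.indicator (.var 0) (Fm.pow (.var 2) n)).imp (.var 2)

theorem varFinset_apply₂ (f : (lang S).Functions 2) (a b : Fm S) :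
    (f.apply₂ a b).varFinset = a.varFinset ∪ b.varFinset := by
  ext n
  simp [Language.Functions.apply₂, Language.Term.varFinset, Fin.exists_fin_two]

theorem varFinset_one : (Fm.one : Fm S).varFinset = ∅ := by
  ext n
  simp [Fm.one, Language.Constants.term, Language.Term.varFinset]

theorem varFinset_pow_subset (k n : ℕ) :
    (Fm.pow (.var k : Fm S) n).varFinset ⊆ {k} := by
  induction n with
  | zero => simp [Fm.pow, varFinset_one]
  | succ n ih =>
    rw [Fm.pow, Fm.mul, varFinset_apply₂]
    exact Finset.union_subset ih (by simp [Language.Term.varFinset])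

theorem varFinset_indicator (a b : Fm S) :
    (Fm.indicator a b).varFinset = a.varFinset ∪ b.varFinset := by
  simp only [Fm.indicator, Fm.meet, Fm.imp, varFinset_apply₂, varFinset_one]
  grind

theorem varFinset_rootLeft_inter_rootRight_subset (n : ℕ) :
    (rootLeft S n).varFinset ∩ (rootRight S n).varFinset ⊆ {0} := by
  have h1 := varFinset_pow_subset (S := S) 1 n
  have h2 := varFinset_pow_subset (S := S) 2 n
  simp only [rootLeft, rootRight, Fm.mul, Fm.imp, varFinset_apply₂, varFinset_indicator,
    Language.Term.varFinset]
  grind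

variable {G : Type u} [CommGroup G] (v : ℕ → Ext G)

open Classical in
theorem realize_indicator (a b : Fm S) :
    (Fm.indicator a b).realize v =
      if a.realize v = b.realize v then Ext.one else Ext.bot := by
  rw [Fm.indicator, realize_meet, realize_meet, realize_imp, realize_imp, realize_one,
    Ext.indicator_eq]

variable {v}

theorem realize_pow_elem {a : Fm S} {g : G} (h : a.realize v = .elem g) (n : ℕ) :
    (a.pow n).realize v = .elem (g ^ n) := by
  induction n with
  | zero => simp [Fm.pow, Ext.one]
  | succ n ih => simp [Fm.pow, ih, h, Ext.mul, pow_succ]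

theorem realize_pow_bot {a : Fm S} (h : a.realize v = .bot) {n : ℕ} (hn : n ≠ 0) :
    (a.pow n).realize v = .bot := by
  obtain ⟨n, rfl⟩ := Nat.exists_eq_succ_of_ne_zero hn
  rw [Fm.pow, realize_mul, h, Ext.mul_comm', Ext.mul]

theorem realize_pow_top {a : Fm S} (h : a.realize v = .top) {n : ℕ} (hn : n ≠ 0) :
    (a.pow n).realize v = .top := by
  obtain ⟨n, rfl⟩ := Nat.exists_eq_succ_of_ne_zero hn
  induction n with
  | zero => simp [Fm.pow, h, Ext.one_mul']
  | succ n ih => rw [Fm.pow, realize_mul, ih (by simp), h, Ext.mul] <;> simp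

/-- Roots are unique in `Ext G` when they are unique in `G`. -/
theorem realize_eq_of_pow_eq {n : ℕ} (hn : n ≠ 0) (hG : ∀ x : G, x ^ n = 1 → x = 1)
    {a b : Fm S} (h : (a.pow n).realize v = (b.pow n).realize v) : a.realize v = b.realize v := by
  cases ha : a.realize v <;> cases hb : b.realize v <;>
    simp_all [realize_pow_elem, realize_pow_bot, realize_pow_top]
  rename_i x y
  have := hG (x / y) (by rw [div_pow, h, div_self'])
  rwa [div_eq_one] at this

theorem rootLeft_imp_rootRight_mem {P : Set ℕ} {p : ℕ} (hp : p ∈ P) (hp0 : p ≠ 0) :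
    (rootLeft S p).imp (rootRight S p) ∈ theoremsOf (varietyV.{u} P S) := by
  classical
  refine mem_theoremsOf_of_one_le fun G _ hG v => ?_
  rw [realize_imp, Ext.one_le_imp]
  simp only [rootLeft, rootRight, realize_mul, realize_imp, realize_indicator]
  split_ifs with hy hz
  · rw [realize_eq_of_pow_eq hp0 (hG p hp) (hy.symm.trans hz), Ext.one_mul', ← Ext.mul_le,
      Ext.one_mul']
    exact Ext.le_refl _
  · exact Or.inr (Or.inl rfl)
  · exact Or.inl rfl
  · exact Or.inl rfl

theorem realize_rootLeft_eq {n : ℕ} {g : G} (h0 : v 0 = .elem (g ^ n)) (h1 : v 1 = .elem g) :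
    (rootLeft S n).realize v = .elem g := by
  classical
  have h : (Language.Term.var 1 : Fm S).realize v = .elem g := h1
  simp [rootLeft, realize_indicator, realize_pow_elem h, h0, h1, Ext.one_mul']

theorem realize_rootRight_eq {n : ℕ} {g : G} (h0 : v 0 = .elem (g ^ n)) (h2 : v 2 = .elem g) :
    (rootRight S n).realize v = .elem g := by
  classical
  have h : (Language.Term.var 2 : Fm S).realize v = .elem g := h2
  simp [rootRight, realize_indicator, realize_pow_elem h, h0, h2, Ext.one, Ext.imp]

end Root

theorem inQ_multiplicative_int {P : Set ℕ} (hP : ∀ p ∈ P, p ≠ 0) :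
    InQ P (ULift.{u} (Multiplicative ℤ)) := by
  rintro p hp ⟨x⟩ hx
  have h : (p : ℤ) * x.toAdd = 0 := by
    have := congrArg (fun y => y.down.toAdd) hx
    simpa using this
  have := hP p hp
  ext
  simpa [this] using h

theorem not_hasCraigInterpolation {S : Set Extra} {Ax : Fm S → Prop}
    (hAx : ∀ (G : Type u) [CommGroup G] (v : ℕ → Ext G) a, Ax a → Ext.le Ext.one (a.realize v))
    {P : Set ℕ} (hprime : ∀ p ∈ P, p.Prime) (hne : P.Nonempty) :
    ¬ HasCraigInterpolation (extensionBy.{u} (Derives Ax) P) := by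
  intro hC
  obtain ⟨p, hp⟩ := hne
  obtain ⟨d, hd1, hd2, hd⟩ := hC (rootLeft S p) (rootRight S p)
    (.hyp (Or.inr (rootLeft_imp_rootRight_mem hp (hprime p hp).ne_zero)))
  have hQ := inQ_multiplicative_int.{u} fun q hq => (hprime q hq).ne_zero
  let g : ULift.{u} (Multiplicative ℤ) := ⟨Multiplicative.ofAdd 1⟩
  let v : ℕ → Ext (ULift.{u} (Multiplicative ℤ)) := fun n =>
    if n = 0 then .elem (g ^ p) else .elem g
  have h1 := extensionBy_sound hAx hd1 hQ v
  have h2 := extensionBy_sound hAx hd2 hQ v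
  rw [realize_rootLeft_eq (g := g) rfl rfl] at h1
  rw [realize_rootRight_eq (g := g) rfl rfl] at h2
  have hmem : g ∈ Subgroup.zpowers (g ^ p) := by
    refine Ext.realize_mem_subgroup _ d v (fun n hn y hy => ?_) g (Ext.le_antisymm h2 h1)
    obtain rfl : n = 0 :=
      Finset.mem_singleton.1 (varFinset_rootLeft_inter_rootRight_subset p (hd hn))
    obtain rfl : g ^ p = y := by simpa [v] using hy
    exact Subgroup.mem_zpowers _
  obtain ⟨k, hk⟩ := hmem
  have hk' : k * (p : ℤ) = 1 := by
    have := congrArg (fun y => y.down.toAdd) hk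
    simpa [g] using this
  have hdvd : (p : ℤ) ∣ 1 := ⟨k, by rw [mul_comm, hk']⟩
  exact (hprime p hp).one_lt.ne' (by exact_mod_cast Int.eq_one_of_dvd_one (by positivity) hdvd)

end LinLog

theorem mainTheorem4 (P : Set ℕ) (hprime : ∀ p ∈ P, p.Prime) (hne : P.Nonempty) :
    ¬ LinLog.HasCraigInterpolation (LinLog.extensionBy.{u} LinLog.LL P) ∧
    ¬ LinLog.HasCraigInterpolation (LinLog.extensionBy.{u} LinLog.MALL P) ∧
    ¬ LinLog.HasCraigInterpolation (LinLog.extensionBy.{u} LinLog.FLe P) ∧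
    ¬ LinLog.HasCraigInterpolation (LinLog.extensionBy.{u} LinLog.RLe P) := by
  refine ⟨LinLog.not_hasCraigInterpolation (fun G _ v a h => ?_) hprime hne,
    LinLog.not_hasCraigInterpolation (fun G _ v a h => ?_) hprime hne,
    LinLog.not_hasCraigInterpolation (fun G _ v a h => h.sound v) hprime hne,
    LinLog.not_hasCraigInterpolation (fun G _ v a h => h.sound v) hprime hne⟩
  · rcases h with h | h | h | h <;> exact h.sound v
  · rcases h with h | h | h <;> exact h.sound v
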